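/- Let $\theta>0$ (the cone angle), $\sigma\in\mathbb R\setminus\{0\}$ (the spin) and $r_0=\sigma/\theta$. The interior region $M^*_{\theta,\sigma}=\{(r,\alpha,\tau): r\ge |r_0|\}$ (with $\alpha$ modulo $2\pi$ and $\tau\in\mathbb R$) of the flat one-particle spacetime carries the metric $$ds^2=-\frac1{\theta^2}\,d\tau^2-\frac{r_0}{\pi}\,d\alpha\,d\tau+\Big(\frac{\theta}{2\pi}\Big)^2(r^2-r_0^2)\,d\alpha^2+dr^2 .$$ Put $r=|r_0|\cosh\xi$. The doubling $M^d_{\theta,\sigma}$ of $M^*_{\theta,\sigma}$ along its boundary $r=|r_0|$ is the manifold $(\mathbb R/2\pi\mathbb Z)\times\mathbb R\times\mathbb R$ with coordinates $(\alpha,\tau,\xi)$; its two halves $\xi\ge 0$ and $\xi\le 0$ are the two copies of $M^*_{\theta,\sigma}$. Let $\eta:[0,\infty)\to[0,1]$ be a smooth non-increasing function that is equal to $1$ on $[0,1/2]$ and to $0$ on $(1,\infty)$, and for $\varepsilon>0$ let $$g_\varepsilon=-\frac1{\theta^2}\,d\tau^2-\frac{r_0}{\pi}\,d\alpha\,d\tau+\Big(r_0^2\sinh^2\xi+\varepsilon\,\eta(|\xi|/\varepsilon)\Big)\Big[\Big(\frac{\theta}{2\pi}\Big)^2d\alpha^2+d\xi^2\Big].$$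 Then for every $\varepsilon>0$, $g_\varepsilon$ is a smooth Lorentzian metric on $M^d_{\theta,\sigma}$ for which $\partial_\tau$ is timelike, and $(M^d_{\theta,\sigma},g_\varepsilon)$, time-oriented by $\partial_\tau$, is globally hyperbolic: it is strongly causal, and $J^+(p)\cap J^-(q)$ is compact for all points $p,q$. Moreover, every level set of $\tau$ is a Cauchy surface: a non-empty embedded spacelike surface that every inextendible causal curve meets exactly once. Here a future-directed causal curve is a locally Lipschitz curve whose velocity exists and is causal and future-directed at almost every parameter; $J^\pm$ are the causal future and past defined by such curves. -/

import Mathlib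

open scoped ContDiff Topology

noncomputable section

namespace SpinParticle

/-- Coordinates `(α, τ, ξ)` on the universal cover, with `α` not yet taken modulo `2π`; also the
components `(v_α, v_τ, v_ξ)` of a tangent vector in the global frame `∂_α, ∂_τ, ∂_ξ`. -/
abbrev Coord : Type := ℝ × ℝ × ℝ

/-- The doubled interior region of the one-particle model: triples `(α, τ, ξ)` with `α` modulo
`2π` and `τ, ξ ∈ ℝ`. The half `ξ ≥ 0` is the interior region `r ≥ |σ / θ|`, through
`r = |σ / θ| cosh ξ`; the half `ξ ≤ 0` is its second copy, glued to the first along the CTC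
surface `ξ = 0`. -/
abbrev DoubledRegion : Type := AddCircle (2 * Real.pi) × ℝ × ℝ

/-- The covering map `ℝ³ → DoubledRegion`, which reduces `α` modulo `2π`. -/
def proj (x : Coord) : DoubledRegion := ((x.1 : AddCircle (2 * Real.pi)), x.2)

/-- The function `τ` on the doubled region. -/
def tau (p : DoubledRegion) : ℝ := p.2.1

/-- The coframe `dα, dτ, dξ`. -/
def dAlpha : Coord →ₗ[ℝ] ℝ := LinearMap.fst ℝ ℝ (ℝ × ℝ)

/-- See `dAlpha`. -/
def dTau : Coord →ₗ[ℝ] ℝ := LinearMap.fst ℝ ℝ ℝ ∘ₗ LinearMap.snd ℝ ℝ (ℝ × ℝ)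

/-- See `dAlpha`. -/
def dXi : Coord →ₗ[ℝ] ℝ := LinearMap.snd ℝ ℝ ℝ ∘ₗ LinearMap.snd ℝ ℝ (ℝ × ℝ)

/-- The coordinate vector field `∂_τ`. -/
def partialTau : Coord := (0, 1, 0)

/-- A bump function `η : [0, ∞) → [0, 1]`: smooth, non-increasing, equal to `1` on `[0, 1/2]` and
to `0` on `(1, ∞)`. Values of `η` at negative numbers play no role. -/
structure IsBump (η : ℝ → ℝ) : Prop where
  smooth : ContDiffOn ℝ ∞ η (Set.Ici 0)
  antitone : AntitoneOn η (Set.Ici 0)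
  mapsTo : Set.MapsTo η (Set.Ici 0) (Set.Icc 0 1)
  eq_one : ∀ s ∈ Set.Icc (0 : ℝ) (1 / 2), η s = 1
  eq_zero : ∀ s ∈ Set.Ioi (1 : ℝ), η s = 0

/-- A field of quadratic forms on the tangent spaces, written `ds²`. -/
abbrev MetricField : Type := DoubledRegion → QuadraticForm ℝ Coord

open QuadraticMap in
/-- The smoothed metric `g_ε` for the cone angle `θ` and the spin `σ`, with `r = σ / θ`:
`-(1/θ²) dτ² - (r/π) dα dτ + (r² sinh² ξ + ε η(|ξ|/ε)) [(θ/2π)² dα² + dξ²]`. -/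
def smoothedMetric (θ σ : ℝ) (η : ℝ → ℝ) (ε : ℝ) : MetricField := fun p =>
  -((1 / θ ^ 2) • linMulLin dTau dTau) - ((σ / θ) / Real.pi) • linMulLin dAlpha dTau
    + ((σ / θ) ^ 2 * Real.sinh p.2.2 ^ 2 + ε * η (|p.2.2| / ε)) •
      ((θ / (2 * Real.pi)) ^ 2 • linMulLin dAlpha dAlpha + linMulLin dXi dXi)

/-- `g` is a smooth metric of signature `(-, +, +)`, time-oriented by the timelike vector field
`∂_τ`: the pair is a spacetime. -/
structure IsSpacetime (g : MetricField) : Prop where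
  smooth : ∀ v : Coord, ContDiff ℝ ∞ fun x : Coord => g (proj x) v
  lorentzian : ∀ p, (g p).Equivalent
    (QuadraticMap.weightedSumSquares ℝ (![-1, 1, 1] : Fin 3 → ℝ))
  timelike : ∀ p, g p partialTau < 0

/-- A tangent vector `v` at `p` is causal and future-directed: `v ≠ 0`, `g(v, v) ≤ 0` and
`g(v, ∂_τ) < 0` (`polar` is twice the bilinear form). -/
def IsFutureCausal (g : MetricField) (p : DoubledRegion) (v : Coord) : Prop :=
  v ≠ 0 ∧ g p v ≤ 0 ∧ QuadraticMap.polar (g p) v partialTau < 0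

/-- The curve `γ`, on the parameter set `I`, has velocity `v` at `t`: some lift `c` of `γ` to the
universal cover near `t` has derivative `v` at `t`. -/
def HasVelocity (γ : ℝ → DoubledRegion) (I : Set ℝ) (t : ℝ) (v : Coord) : Prop :=
  ∃ c : ℝ → Coord, (∀ᶠ s in 𝓝[I] t, proj (c s) = γ s) ∧ HasDerivWithinAt c v I t

/-- `γ` restricted to `I` is a future-directed causal curve: it is locally Lipschitz, and at almost
every parameter its velocity exists and is causal and future-directed. Piecewise `C¹` curves with
causal future-directed velocities are of this kind. -/
def IsCausalCurveOn (g : MetricField) (γ : ℝ → DoubledRegion) (I : Set ℝ) : Prop :=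
  LocallyLipschitzOn I γ ∧
    ∀ᵐ t : ℝ, t ∈ I → ∃ v, HasVelocity γ I t v ∧ IsFutureCausal g (γ t) v

/-- `γ` is an inextendible causal curve with the interval `I` as domain: a causal curve without a
limit point at either end. At an end that belongs to `I` the filter below is the principal filter
of that end, so there the limit exists and the curve counts as extendible. As
reversal changes neither the image of a curve nor its inextendibility, past-directed curves need
no separate treatment. -/
structure IsInextendibleCausalCurve (g : MetricField) (γ : ℝ → DoubledRegion) (I : Set ℝ) :
    Prop where
  ordConnected : I.OrdConnected
  nontrivial : I.Nontrivial
  causal : IsCausalCurveOn g γ I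
  no_future_endpoint : ¬ ∃ p, Filter.Tendsto (fun t : I => γ t) Filter.atTop (𝓝 p)
  no_past_endpoint : ¬ ∃ p, Filter.Tendsto (fun t : I => γ t) Filter.atBot (𝓝 p)

/-- The causal future `J⁺(p)`. -/
def causalFuture (g : MetricField) (p : DoubledRegion) : Set DoubledRegion :=
  {q | q = p ∨ ∃ (a b : ℝ) (γ : ℝ → DoubledRegion), a < b ∧
    IsCausalCurveOn g γ (Set.Icc a b) ∧ γ a = p ∧ γ b = q}

/-- The causal past `J⁻(q)`. -/
def causalPast (g : MetricField) (q : DoubledRegion) : Set DoubledRegion :=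
  {p | q ∈ causalFuture g p}

/-- Strong causality: every neighbourhood `U` of a point contains a neighbourhood `V` of that point
such that every causal curve with both endpoints in `V` stays in `U`. -/
def IsStronglyCausal (g : MetricField) : Prop :=
  ∀ p, ∀ U ∈ 𝓝 p, ∃ V ∈ 𝓝 p, V ⊆ U ∧ ∀ (a b : ℝ) (γ : ℝ → DoubledRegion), a < b →
    IsCausalCurveOn g γ (Set.Icc a b) → γ a ∈ V → γ b ∈ V → ∀ t ∈ Set.Icc a b, γ t ∈ U

/-- Global hyperbolicity of a spacetime: strong causality and compactness of all causal diamonds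
`J⁺(p) ∩ J⁻(q)`. -/
structure IsGloballyHyperbolic (g : MetricField) : Prop where
  spacetime : IsSpacetime g
  stronglyCausal : IsStronglyCausal g
  compact_diamond : ∀ p q, IsCompact (causalFuture g p ∩ causalPast g q)

/-- `S` is an embedded smooth spacelike surface: near each of its points it is the zero set of a
smooth function `f` with `df ≠ 0` there, and `g` is positive definite on the tangent plane
`ker df`. -/
def IsSpacelikeSurface (g : MetricField) (S : Set DoubledRegion) : Prop :=
  ∀ x : Coord, proj x ∈ S → ∃ U ∈ 𝓝 x, ∃ f : Coord → ℝ, ContDiff ℝ ∞ f ∧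
    fderiv ℝ f x ≠ 0 ∧ (∀ y ∈ U, proj y ∈ S ↔ f y = 0) ∧
    ∀ v : Coord, v ≠ 0 → fderiv ℝ f x v = 0 → 0 < g (proj x) v

/-- A Cauchy surface: a spacelike surface that every inextendible causal curve meets at exactly one
parameter. -/
structure IsCauchySurface (g : MetricField) (S : Set DoubledRegion) : Prop where
  nonempty : S.Nonempty
  spacelike : IsSpacelikeSurface g S
  meets_once : ∀ (γ : ℝ → DoubledRegion) (I : Set ℝ), IsInextendibleCausalCurve g γ I →
    ∃! t, t ∈ I ∧ γ t ∈ S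

end SpinParticle

end

/-! With `T = τ/θ`, `w = θα/2π` and `ρ = σ/θ` the metric is `-dT² - 2ρ dw dT + F(ξ)(dw² + dξ²)`. The
bump keeps the conformal factor `F` above some `c > 0` (`exists_pos_le_confFactor`). A vector is
future causal iff `dT > 0` on it and its velocity with respect to `T`, read in the `w + iξ` plane,
lies in the closed disc with centre `ρ/F` and radius `√(1/F + ρ²/F²)` (`isFutureCausal_iff`). Since
`F ≥ c`, these discs are uniformly bounded.

So `τ` increases strictly along a causal curve, and the distance travelled is at most a constant
times the increase of `τ` (`IsCausalCurveOn.dist_le`). This gives strong causality at once. It also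
gives the Cauchy property: a curve on which `τ` stays bounded towards an end converges there.

For the diamonds, causal curves parametrized by `T` are the solutions of a differential inclusion
with discs as values. In integrated form (`IsTrajectory`) the inclusion survives uniform limits, so
Arzelà–Ascoli makes the solutions compact (`IsTrajectory.isCompact_setOf`). A diamond is a
continuous image of such a compact set. -/

open Set Filter MeasureTheory

namespace SpinParticle

/-! ### Mean value inequalities from almost everywhere derivative bounds. -/

/-- A Lipschitz function whose derivative is nonpositive almost everywhere does not increase. -/
theorem le_of_ae_deriv_nonpos {f : ℝ → ℝ} {a b : ℝ} {K : NNReal} (hab : a ≤ b)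
    (hf : LipschitzOnWith K f (Icc a b))
    (H : ∀ᵐ t : ℝ, t ∈ Icc a b → ∃ f', HasDerivWithinAt f f' (Icc a b) t ∧ f' ≤ 0) :
    f b ≤ f a := by
  have hac : AbsolutelyContinuousOnInterval f a b := by
    apply LipschitzOnWith.absolutelyContinuousOnInterval (K := K)
    rwa [uIcc_of_le hab]
  have h1 := hac.integral_deriv_eq_sub
  have h2 : ∫ x in a..b, deriv f x ≤ 0 := by
    rw [intervalIntegral.integral_of_le hab, integral_Ioc_eq_integral_Ioo]
    apply integral_nonpos_of_ae
    rw [EventuallyLE, ae_restrict_iff' measurableSet_Ioo]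
    filter_upwards [H] with t ht hmem
    obtain ⟨f', hd, hle⟩ := ht (Ioo_subset_Icc_self hmem)
    rw [(hd.hasDerivAt (Icc_mem_nhds hmem.1 hmem.2)).deriv]
    exact hle
  linarith

/-- A mean value inequality for Lipschitz functions, from an almost everywhere bound on the
derivative. -/
theorem norm_sub_le_of_ae_deriv {f : ℝ → ℂ} {h : ℝ → ℝ} {a b : ℝ} {K K' : NNReal} (hab : a ≤ b)
    (hf : LipschitzOnWith K f (Icc a b)) (hh : LipschitzOnWith K' h (Icc a b))
    (H : ∀ᵐ t : ℝ, t ∈ Icc a b → ∃ f' h', HasDerivWithinAt f f' (Icc a b) t ∧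
      HasDerivWithinAt h h' (Icc a b) t ∧ ‖f'‖ ≤ h') :
    ‖f b - f a‖ ≤ h b - h a := by
  -- The unit `u` rotates the increment of `f` onto the positive real axis, which reduces the claim
  -- to the real function `Re (u f) - h`.
  obtain ⟨u, hu, huw⟩ : ∃ u : ℂ, ‖u‖ = 1 ∧ (u * (f b - f a)).re = ‖f b - f a‖ := by
    by_cases hw : f b - f a = 0
    · exact ⟨1, by simp, by simp [hw]⟩
    · have hn : ‖f b - f a‖ ≠ 0 := norm_ne_zero_iff.mpr hw
      refine ⟨(starRingEnd ℂ) (f b - f a) / ‖f b - f a‖, ?_, ?_⟩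
      · rw [norm_div, RCLike.norm_conj, Complex.norm_real, norm_norm, div_self hn]
      · rw [div_mul_eq_mul_div, ← Complex.normSq_eq_conj_mul_self, Complex.normSq_eq_norm_sq,
          ← Complex.ofReal_div, Complex.ofReal_re]
        field_simp
  let L : ℂ →L[ℝ] ℝ := Complex.reCLM.comp (ContinuousLinearMap.mul ℝ ℂ u)
  have hL : ∀ z, L z = (u * z).re := fun z => rfl
  have hLle : ∀ z, L z ≤ ‖z‖ := fun z => by
    rw [hL]
    calc (u * z).re ≤ ‖u * z‖ := Complex.re_le_norm _
      _ = ‖z‖ := by rw [norm_mul, hu, one_mul]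
  have key := le_of_ae_deriv_nonpos (f := fun t => L (f t) - h t) hab
    ((L.lipschitz.comp_lipschitzOnWith hf).sub hh) (by
      filter_upwards [H] with t ht hmem
      obtain ⟨f', h', h1, h2, h3⟩ := ht hmem
      refine ⟨L f' - h', (L.hasFDerivAt.comp_hasDerivWithinAt t h1).sub h2, ?_⟩
      linarith [hLle f'])
  have : L (f b) - L (f a) = ‖f b - f a‖ := by rw [← map_sub, hL, huw]
  linarith

/-- A Lipschitz function whose derivative is positive almost everywhere increases strictly. -/
theorem lt_of_ae_deriv_pos {f : ℝ → ℝ} {a b : ℝ} {K : NNReal} (hab : a < b)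
    (hf : LipschitzOnWith K f (Icc a b))
    (H : ∀ᵐ t : ℝ, t ∈ Icc a b → ∃ f', HasDerivWithinAt f f' (Icc a b) t ∧ 0 < f') :
    f a < f b := by
  have mono : ∀ s t, a ≤ s → s ≤ t → t ≤ b → f s ≤ f t := by
    intro s t has hst htb
    have hsub : Icc s t ⊆ Icc a b := Icc_subset_Icc has htb
    have := le_of_ae_deriv_nonpos (f := fun x => -f x) hst (hf.mono hsub).neg (by
      filter_upwards [H] with x hx hmem
      obtain ⟨f', h1, h2⟩ := hx (hsub hmem)
      exact ⟨-f', (h1.mono hsub).neg, by linarith⟩)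
    linarith
  -- A monotone function without strict increase is constant, so its derivative is nowhere positive
  -- and the interval would be a null set.
  by_contra hcon
  have hconst : ∀ t ∈ Icc a b, f t = f a := fun t ht =>
    le_antisymm ((mono t b ht.1 ht.2 le_rfl).trans (not_lt.mp hcon)) (mono a t le_rfl ht.1 ht.2)
  have hfalse : ∀ᵐ t : ℝ, t ∉ Icc a b := by
    filter_upwards [H] with t ht hmem
    obtain ⟨f', h1, h2⟩ := ht hmem
    have h3 : HasDerivWithinAt f 0 (Icc a b) t :=
      (hasDerivWithinAt_const t (Icc a b) (f a)).congr hconst (hconst t hmem)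
    exact h2.ne' ((uniqueDiffOn_Icc hab t hmem).eq_deriv _ h1 h3)
  have : volume (Icc a b) = 0 := measure_eq_zero_iff_ae_notMem.mpr hfalse
  rw [Real.volume_Icc, ENNReal.ofReal_eq_zero] at this
  linarith

/-! ### Lifting curves from the circle to the line. -/

/-- Path lifting for `ℝ → AddCircle p`, over a compact interval. -/
theorem exists_continuous_lift_addCircle (p : ℝ) {a b : ℝ} (hab : a < b) {γ : ℝ → AddCircle p}
    (hγ : ContinuousOn γ (Icc a b)) :
    ∃ c : ℝ → ℝ, Continuous c ∧ ∀ t ∈ Icc a b, (c t : AddCircle p) = γ t := by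
  let γ' : C(unitInterval, AddCircle p) :=
    ⟨fun s => γ (a + s * (b - a)), by
      refine hγ.comp_continuous (by fun_prop) fun s => ⟨?_, ?_⟩
      · nlinarith [s.2.1]
      · nlinarith [s.2.2]⟩
  obtain ⟨e, he⟩ := QuotientAddGroup.mk_surjective (γ' 0)
  obtain ⟨Γ, hΓ, -⟩ := (AddCircle.isCoveringMap_coe p).exists_path_lifts γ' e he.symm
  -- Clamping the parameter extends the lift continuously to the whole line.
  refine ⟨fun t => Γ (projIcc 0 1 zero_le_one ((t - a) / (b - a))), by fun_prop, fun t ht => ?_⟩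
  have hba : 0 < b - a := sub_pos.mpr hab
  have hmem : (t - a) / (b - a) ∈ Icc (0 : ℝ) 1 :=
    ⟨div_nonneg (sub_nonneg.mpr ht.1) hba.le, (div_le_one hba).mpr (by linarith [ht.2])⟩
  have := congrFun hΓ (projIcc 0 1 zero_le_one ((t - a) / (b - a)))
  refine this.trans ?_
  change γ (a + (projIcc 0 1 zero_le_one ((t - a) / (b - a)) : ℝ) * (b - a)) = γ t
  rw [projIcc_of_mem _ hmem]
  congr 1
  field_simp
  ring

theorem dist_eq_dist_coe_addCircle {p : ℝ} (hp : p ≠ 0) {x y : ℝ} (h : |x - y| ≤ |p| / 2) :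
    dist x y = dist (x : AddCircle p) y := by
  rw [dist_eq_norm, dist_eq_norm, ← AddCircle.coe_sub,
    (AddCircle.norm_coe_eq_abs_iff p hp).mpr h, Real.norm_eq_abs]

/-- Continuity keeps the lift within a quarter period of `c t` near `t`. Two such values are less
than half a period apart, where the quotient map preserves distances. -/
theorem locallyLipschitzOn_lift_addCircle {p : ℝ} (hp : p ≠ 0) {I : Set ℝ} {c : ℝ → ℝ}
    (hc : Continuous c) (h : LocallyLipschitzOn I fun t => (c t : AddCircle p)) :
    LocallyLipschitzOn I c := by
  intro t ht
  obtain ⟨K, U, hU, hK⟩ := h ht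
  have hp' : 0 < |p| / 4 := by positivity
  have hball : c ⁻¹' Metric.ball (c t) (|p| / 4) ∈ 𝓝[I] t :=
    nhdsWithin_le_nhds (hc.continuousAt (Metric.ball_mem_nhds _ hp'))
  refine ⟨K, U ∩ c ⁻¹' Metric.ball (c t) (|p| / 4), inter_mem hU hball, ?_⟩
  refine LipschitzOnWith.of_dist_le_mul fun x hx y hy => ?_
  rw [dist_eq_dist_coe_addCircle hp]
  · exact hK.dist_le_mul x hx.1 y hy.1
  · rw [← Real.dist_eq]
    have h1 : dist (c x) (c t) < |p| / 4 := hx.2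
    have h2 : dist (c y) (c t) < |p| / 4 := hy.2
    linarith [dist_triangle_right (c x) (c y) (c t)]

/-- Two lifts of a curve in `AddCircle p` have the same derivative. -/
theorem hasDerivWithinAt_lift_addCircle {p : ℝ} (hp : p ≠ 0) {I : Set ℝ} {t v : ℝ} (ht : t ∈ I)
    {c d : ℝ → ℝ} (hc : ContinuousWithinAt c I t) (hd : HasDerivWithinAt d v I t)
    (h : ∀ᶠ s in 𝓝[I] t, (d s : AddCircle p) = c s) : HasDerivWithinAt c v I t := by
  have hcont : ContinuousWithinAt (fun s => c s - d s) I t := hc.sub hd.continuousWithinAt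
  have hp' : 0 < |p| / 2 := by positivity
  -- `c - d` is continuous with values in the discrete group `pℤ`, hence constant near `t`.
  have hev : ∀ᶠ s in 𝓝[I] t, c s = d s + (c t - d t) := by
    filter_upwards [h, hcont (Metric.ball_mem_nhds _ hp')] with s hs hs'
    have h1 : |(c s - d s) - (c t - d t)| ≤ |p| / 2 := by
      rw [← Real.dist_eq]; exact (Metric.mem_ball.mp hs').le
    have h2 := dist_eq_dist_coe_addCircle hp h1
    rw [AddCircle.coe_sub, AddCircle.coe_sub, hs, h.self_of_nhdsWithin ht, sub_self, sub_self,
      dist_self, dist_eq_zero] at h2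
    linarith
  exact (hd.add_const _).congr_of_eventuallyEq hev (by ring)

/-- A causal curve on a compact interval has a Lipschitz lift to the universal cover. -/
theorem IsCausalCurveOn.exists_lift {g : MetricField} {γ : ℝ → DoubledRegion} {a b : ℝ}
    (hab : a < b) (hγ : IsCausalCurveOn g γ (Icc a b)) :
    ∃ (c : ℝ → Coord) (K : NNReal), LipschitzOnWith K c (Icc a b) ∧
      (∀ t ∈ Icc a b, proj (c t) = γ t) ∧
      ∀ᵐ t : ℝ, t ∈ Icc a b →
        ∃ v, HasDerivWithinAt c v (Icc a b) t ∧ IsFutureCausal g (proj (c t)) v := by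
  have hp : 2 * Real.pi ≠ 0 := by positivity
  obtain ⟨L, hL⟩ := hγ.1.exists_lipschitzOnWith_of_compact isCompact_Icc
  have hL1 : LipschitzOnWith L (fun t => (γ t).1) (Icc a b) :=
    LipschitzOnWith.of_dist_le_mul fun x hx y hy =>
      (le_max_left _ _).trans (hL.dist_le_mul x hx y hy)
  have hL2 : LipschitzOnWith L (fun t => (γ t).2) (Icc a b) :=
    LipschitzOnWith.of_dist_le_mul fun x hx y hy =>
      (le_max_right _ _).trans (hL.dist_le_mul x hx y hy)
  obtain ⟨α, hα, hlift⟩ := exists_continuous_lift_addCircle (2 * Real.pi) hab hL1.continuousOn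
  have hαL : LocallyLipschitzOn (Icc a b) α := by
    refine locallyLipschitzOn_lift_addCircle hp hα ?_
    refine fun t _ => ⟨L, Icc a b, self_mem_nhdsWithin, fun x hx y hy => ?_⟩
    simpa only [hlift x hx, hlift y hy] using hL1 hx hy
  obtain ⟨K, hK⟩ := hαL.exists_lipschitzOnWith_of_compact isCompact_Icc
  have hproj : ∀ t ∈ Icc a b, proj (α t, (γ t).2) = γ t := fun t ht => by
    simp only [proj, hlift t ht]
  refine ⟨fun t => (α t, (γ t).2), max K L, hK.prodMk hL2, hproj, ?_⟩
  filter_upwards [hγ.2] with t ht hmem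
  obtain ⟨v, ⟨d, hd, hdv⟩, hv⟩ := ht hmem
  refine ⟨v, ?_, by rwa [hproj t hmem]⟩
  have hd1 : HasDerivWithinAt (fun s => (d s).1) v.1 (Icc a b) t :=
    (ContinuousLinearMap.fst ℝ ℝ (ℝ × ℝ)).hasFDerivAt.comp_hasDerivWithinAt t hdv
  have hd2 : HasDerivWithinAt (fun s => (d s).2) v.2 (Icc a b) t :=
    (ContinuousLinearMap.snd ℝ ℝ (ℝ × ℝ)).hasFDerivAt.comp_hasDerivWithinAt t hdv
  refine (hasDerivWithinAt_lift_addCircle hp hmem hα.continuousWithinAt hd1 ?_).prodMk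
    (hd2.congr_of_eventuallyEq_of_mem ?_ hmem)
  · filter_upwards [hd, self_mem_nhdsWithin] with s hs hs'
    rw [hlift s hs', ← hs]; rfl
  · filter_upwards [hd] with s hs
    rw [← hs]; rfl

/-! ### Trajectories of the differential inclusion. -/

/-- Integrated form of the differential inclusion `ζ' ∈ closedBall (m (Im ζ)) (R (Im ζ))`. Unlike
the almost everywhere form, it passes to uniform limits directly. -/
structure IsTrajectory (m R : ℝ → ℝ) (ζ : ℝ → ℂ) (a b : ℝ) : Prop where
  continuous : Continuous ζ
  norm_sub_le : ∀ s t, a ≤ s → s ≤ t → t ≤ b →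
    ‖ζ t - ζ s - (∫ u in s..t, m (ζ u).im : ℝ)‖ ≤ ∫ u in s..t, R (ζ u).im

namespace IsTrajectory

variable {m R : ℝ → ℝ} {ζ : ℝ → ℂ} {a b : ℝ}

theorem mono (h : IsTrajectory m R ζ a b) {a' b' : ℝ} (ha : a ≤ a') (hb : b' ≤ b) :
    IsTrajectory m R ζ a' b' :=
  ⟨h.continuous, fun s t hs hst ht => h.norm_sub_le s t (ha.trans hs) hst (ht.trans hb)⟩

/-- The hypothesis puts `0` in every disc, so standing still is allowed. -/
theorem const (hmR : ∀ x, |m x| ≤ R x) (z : ℂ) (a b : ℝ) : IsTrajectory m R (fun _ => z) a b := by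
  refine ⟨continuous_const, fun s t _ hst _ => ?_⟩
  simp only [sub_self, zero_sub, norm_neg, intervalIntegral.integral_const, smul_eq_mul,
    Complex.norm_real, Real.norm_eq_abs, abs_mul, abs_of_nonneg (sub_nonneg.mpr hst)]
  exact mul_le_mul_of_nonneg_left (hmR _) (sub_nonneg.mpr hst)

/-- The discs depend on the imaginary part only; deck transformations are real translations. -/
theorem add_real (h : IsTrajectory m R ζ a b) (k : ℝ) :
    IsTrajectory m R (fun t => ζ t + k) a b := by
  refine ⟨h.continuous.add continuous_const, fun s t hs hst ht => ?_⟩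
  simpa using h.norm_sub_le s t hs hst ht

theorem trans (hm : Continuous m) (hR : Continuous R) {ζ' : ℝ → ℂ} {c : ℝ}
    (h : IsTrajectory m R ζ a c) (h' : IsTrajectory m R ζ' c b) (hc : ζ c = ζ' c) :
    IsTrajectory m R (fun t => if t ≤ c then ζ t else ζ' t) a b := by
  set Z : ℝ → ℂ := fun t => if t ≤ c then ζ t else ζ' t with hZ
  have hcont : Continuous Z := Continuous.if_le h.continuous h'.continuous continuous_id
    continuous_const (by rintro x rfl; exact hc)
  have hle : ∀ t ≤ c, Z t = ζ t := fun t ht => if_pos ht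
  have hge : ∀ t, c ≤ t → Z t = ζ' t := fun t ht => by
    rcases ht.eq_or_lt with rfl | ht
    · rw [hle _ le_rfl, hc]
    · exact if_neg (not_le.mpr ht)
  have int : ∀ {φ : ℝ → ℝ}, Continuous φ → ∀ s t,
      IntervalIntegrable (fun u => φ (Z u).im) volume s t := fun hφ s t =>
    (hφ.comp (Complex.continuous_im.comp hcont)).intervalIntegrable s t
  have left : ∀ s t, a ≤ s → s ≤ t → t ≤ c →
      ‖Z t - Z s - (∫ u in s..t, m (Z u).im : ℝ)‖ ≤ ∫ u in s..t, R (Z u).im := by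
    intro s t hs hst ht
    have e : ∀ φ : ℝ → ℝ, ∫ u in s..t, φ (Z u).im = ∫ u in s..t, φ (ζ u).im := fun φ =>
      intervalIntegral.integral_congr fun u hu => by
        rw [uIcc_of_le hst] at hu
        simp only [hle u (hu.2.trans ht)]
    rw [e, e, hle _ ht, hle _ (hst.trans ht)]
    exact h.norm_sub_le s t hs hst ht
  have right : ∀ s t, c ≤ s → s ≤ t → t ≤ b →
      ‖Z t - Z s - (∫ u in s..t, m (Z u).im : ℝ)‖ ≤ ∫ u in s..t, R (Z u).im := by
    intro s t hs hst ht
    have e : ∀ φ : ℝ → ℝ, ∫ u in s..t, φ (Z u).im = ∫ u in s..t, φ (ζ' u).im := fun φ =>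
      intervalIntegral.integral_congr fun u hu => by
        rw [uIcc_of_le hst] at hu
        simp only [hge u (hs.trans hu.1)]
    rw [e, e, hge _ hs, hge _ (hs.trans hst)]
    exact h'.norm_sub_le s t hs hst ht
  refine ⟨hcont, fun s t hs hst ht => ?_⟩
  rcases le_total t c with htc | htc
  · exact left s t hs hst htc
  rcases le_total c s with hsc | hsc
  · exact right s t hsc hst ht
  have h1 := left s c hs hsc le_rfl
  have h2 := right c t le_rfl htc ht
  rw [← intervalIntegral.integral_add_adjacent_intervals (int hm s c) (int hm c t),
    ← intervalIntegral.integral_add_adjacent_intervals (int hR s c) (int hR c t)]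
  calc _ = ‖(Z c - Z s - (∫ u in s..c, m (Z u).im : ℝ))
          + (Z t - Z c - (∫ u in c..t, m (Z u).im : ℝ))‖ := by
        congr 1; push_cast; ring
    _ ≤ _ := (norm_add_le _ _).trans (add_le_add h1 h2)

/-- Discs with centre and radius bounded by `B` lie within `2 * B` of the origin. -/
theorem norm_sub_le_mul {B : ℝ} (hmB : ∀ x, |m x| ≤ B) (hRB : ∀ x, |R x| ≤ B)
    (h : IsTrajectory m R ζ a b) {s t : ℝ} (hs : a ≤ s) (hst : s ≤ t) (ht : t ≤ b) :
    ‖ζ t - ζ s‖ ≤ 2 * B * (t - s) := by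
  have bd : ∀ {φ : ℝ → ℝ}, (∀ x, |φ x| ≤ B) → ‖∫ u in s..t, φ (ζ u).im‖ ≤ B * (t - s) := by
    intro φ hφ
    have := intervalIntegral.norm_integral_le_of_norm_le_const (a := s) (b := t)
      (f := fun u => φ (ζ u).im) (C := B) fun x _ => hφ _
    rwa [abs_of_nonneg (sub_nonneg.mpr hst)] at this
  have h1 := h.norm_sub_le s t hs hst ht
  have h2 := bd hmB
  have h3 := (le_abs_self _).trans (bd hRB)
  rw [← Complex.norm_real] at h2
  have h4 := norm_add_le (ζ t - ζ s - (∫ u in s..t, m (ζ u).im : ℝ))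
    ((∫ u in s..t, m (ζ u).im : ℝ) : ℂ)
  rw [sub_add_cancel] at h4
  linarith

theorem lipschitzOnWith {B : ℝ} (hmB : ∀ x, |m x| ≤ B) (hRB : ∀ x, |R x| ≤ B)
    (h : IsTrajectory m R ζ a b) : LipschitzOnWith (2 * B).toNNReal ζ (Icc a b) := by
  have hB : 0 ≤ B := (abs_nonneg _).trans (hmB 0)
  refine LipschitzOnWith.of_dist_le_mul fun s hs t ht => ?_
  rw [Real.coe_toNNReal _ (by positivity)]
  rcases le_total s t with hst | hst
  · rw [dist_comm, dist_eq_norm, dist_comm s, Real.dist_eq, abs_of_nonneg (sub_nonneg.mpr hst)]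
    exact h.norm_sub_le_mul hmB hRB hs.1 hst ht.2
  · rw [dist_eq_norm, Real.dist_eq, abs_of_nonneg (sub_nonneg.mpr hst)]
    exact h.norm_sub_le_mul hmB hRB ht.1 hst hs.2

/-- A Lipschitz curve is differentiable almost everywhere. There, dividing the integrated inequality
by the length of the interval and letting it shrink recovers the pointwise inclusion. Slopes are
taken from the right, so `b` is discarded. -/
theorem ae_hasDerivWithinAt {B : ℝ} (hm : Continuous m) (hR : Continuous R)
    (hmB : ∀ x, |m x| ≤ B) (hRB : ∀ x, |R x| ≤ B) (h : IsTrajectory m R ζ a b) :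
    ∀ᵐ t : ℝ, t ∈ Icc a b →
      ∃ v, HasDerivWithinAt ζ v (Icc a b) t ∧ ‖v - m (ζ t).im‖ ≤ R (ζ t).im := by
  have hne : ∀ᵐ t : ℝ, t ≠ b := by simp [ae_iff, measure_singleton]
  filter_upwards [(h.lipschitzOnWith hmB hRB).ae_differentiableWithinAt_of_mem_real, hne]
    with t hdiff htb hmem
  have hd := (hdiff hmem).hasDerivWithinAt
  refine ⟨_, hd, ?_⟩
  set v := derivWithin ζ (Icc a b) t
  have hlt : t < b := lt_of_le_of_ne hmem.2 htb
  have prim : ∀ {φ : ℝ → ℝ}, Continuous φ →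
      HasDerivAt (fun s => ∫ u in t..s, φ (ζ u).im) (φ (ζ t).im) t := fun hφ =>
    ((hφ.comp (Complex.continuous_im.comp h.continuous)).integral_hasStrictDerivAt t t).hasDerivAt
  have hd' : HasDerivWithinAt ζ v (Ioi t) t :=
    (hd.mono (Icc_subset_Icc_left hmem.1)).mono_of_mem_nhdsWithin
      (mem_of_superset (Ioo_mem_nhdsGT hlt) Ioo_subset_Icc_self)
  have d1 : HasDerivWithinAt (fun s => ζ s - ((∫ u in t..s, m (ζ u).im : ℝ) : ℂ))
      (v - m (ζ t).im) (Ioi t) t := hd'.sub (prim hm).ofReal_comp.hasDerivWithinAt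
  have d2 := (prim hR).hasDerivWithinAt (s := Ioi t)
  rw [hasDerivWithinAt_iff_tendsto_slope' self_notMem_Ioi] at d1 d2
  refine le_of_tendsto_of_tendsto d1.norm d2 ?_
  filter_upwards [Ioo_mem_nhdsGT hlt] with s hs
  have hpos : 0 < s - t := sub_pos.mpr hs.1
  simp only [slope_def_module, intervalIntegral.integral_same, Complex.ofReal_zero, sub_zero,
    smul_eq_mul, norm_smul, norm_inv, Real.norm_eq_abs, abs_of_pos hpos]
  refine mul_le_mul_of_nonneg_left ?_ (inv_nonneg.mpr hpos.le)
  have := h.norm_sub_le t s hmem.1 hs.1.le hs.2.le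
  rwa [sub_right_comm] at this

/-- Points on trajectories from a fixed starting point to a closed set form a compact set. -/
theorem isCompact_setOf {B : ℝ} (hm : Continuous m) (hR : Continuous R)
    (hmB : ∀ x, |m x| ≤ B) (hRB : ∀ x, |R x| ≤ B) (a b : ℝ) (z : ℂ) {E : Set ℂ}
    (hE : IsClosed E) :
    IsCompact {x : ℝ × ℂ | ∃ ζ : ℝ → ℂ, IsTrajectory m R ζ a b ∧ ζ a = z ∧ ζ b ∈ E ∧
      x.1 ∈ Icc a b ∧ x.2 = ζ x.1} := by
  rcases lt_or_ge b a with hab | hab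
  · convert! isCompact_empty
    ext x
    simp only [mem_ofPred_eq, mem_empty_iff_false, iff_false, Icc_eq_empty (not_le.mpr hab)]
    tauto
  have hB : 0 ≤ B := (abs_nonneg _).trans (hmB 0)
  -- Functions on `[a, b]` are frozen beyond its ends, because a trajectory is continuous on all of
  -- `ℝ`.
  let ext : BoundedContinuousFunction (Icc a b) ℂ → ℝ → ℂ := fun f u => f (projIcc a b hab u)
  have hext : Continuous (Function.uncurry ext) := by
    exact continuous_fst.eval (continuous_projIcc.comp continuous_snd)
  have hext' : ∀ t, Continuous fun f => ext f t := fun t =>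
    hext.comp (continuous_id.prodMk continuous_const)
  have hint : ∀ {φ : ℝ → ℝ}, Continuous φ → ∀ s t,
      Continuous fun f => ∫ u in s..t, φ (ext f u).im := fun {φ} hφ s t =>
    intervalIntegral.continuous_parametric_intervalIntegral_of_continuous'
      (f := fun f u => φ (ext f u).im) (hφ.comp (Complex.continuous_im.comp hext)) s t
  let K : Set (BoundedContinuousFunction (Icc a b) ℂ) :=
    {f | IsTrajectory m R (ext f) a b ∧ ext f a = z ∧ ext f b ∈ E}
  -- Both sides of the integrated inequality depend continuously on `f` in the uniform norm.
  have hKclosed : IsClosed K := by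
    have : K = {f | ∀ s t, a ≤ s → s ≤ t → t ≤ b →
        ‖ext f t - ext f s - (∫ u in s..t, m (ext f u).im : ℝ)‖ ≤ ∫ u in s..t, R (ext f u).im} ∩
        ({f | ext f a = z} ∩ {f | ext f b ∈ E}) := by
      ext f
      exact ⟨fun h => ⟨h.1.norm_sub_le, h.2⟩,
        fun h => ⟨⟨hext.comp (continuous_const.prodMk continuous_id), h.1⟩, h.2⟩⟩
    rw [this]
    refine IsClosed.inter ?_ ((isClosed_eq (hext' a) continuous_const).inter
      (hE.preimage (hext' b)))
    simp only [ofPred_forall]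
    refine isClosed_iInter fun s => isClosed_iInter fun t => isClosed_iInter fun _ =>
      isClosed_iInter fun _ => isClosed_iInter fun _ => isClosed_le ?_ (hint hR s t)
    exact (((hext' t).sub (hext' s)).sub (Complex.continuous_ofReal.comp (hint hm s t))).norm
  have hval : ∀ (f : BoundedContinuousFunction (Icc a b) ℂ) (x : Icc a b), f x = ext f x :=
    fun f x => by simp only [ext, projIcc_val]
  have hKcompact : IsCompact K := by
    refine BoundedContinuousFunction.arzela_ascoli₂ (Metric.closedBall z (2 * B * (b - a)))
      (isCompact_closedBall _ _) K hKclosed ?_ ?_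
    · rintro f x ⟨h1, h2, -⟩
      rw [mem_closedBall_iff_norm, ← h2, hval]
      refine (h1.norm_sub_le_mul hmB hRB le_rfl x.2.1 x.2.2).trans ?_
      exact mul_le_mul_of_nonneg_left (by linarith [x.2.2]) (by positivity)
    · refine (LipschitzWith.uniformEquicontinuous _ (2 * B).toNNReal ?_).equicontinuous
      rintro ⟨f, hf⟩
      refine LipschitzWith.of_dist_le_mul fun x y => ?_
      simp only [hval]
      exact (hf.1.lipschitzOnWith hmB hRB).dist_le_mul x x.2 y y.2
  have himage : IsCompact ((fun q : BoundedContinuousFunction (Icc a b) ℂ × ℝ =>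
      (q.2, ext q.1 q.2)) '' (K ×ˢ Icc a b)) :=
    (hKcompact.prod isCompact_Icc).image (continuous_snd.prodMk hext)
  convert! himage using 1
  ext ⟨t, w⟩
  constructor
  · rintro ⟨ζ, hζ, ha, hb, ht, hw⟩
    obtain rfl : w = ζ t := hw
    let f : BoundedContinuousFunction (Icc a b) ℂ :=
      BoundedContinuousFunction.mkOfCompact ⟨fun x => ζ x, hζ.continuous.comp continuous_subtype_val⟩
    have hf : ∀ u ∈ Icc a b, ext f u = ζ u := fun u hu => by
      simp only [ext, projIcc_of_mem _ hu]; rfl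
    refine ⟨(f, t), ⟨⟨⟨hext.comp (continuous_const.prodMk continuous_id), ?_⟩, ?_, ?_⟩, ht⟩, ?_⟩
    · intro s t hs hst ht
      have e : ∀ φ : ℝ → ℝ, ∫ u in s..t, φ (ext f u).im = ∫ u in s..t, φ (ζ u).im := fun φ =>
        intervalIntegral.integral_congr fun u hu => by
          rw [uIcc_of_le hst] at hu
          simp only [hf u ⟨hs.trans hu.1, hu.2.trans ht⟩]
      rw [e, e, hf s ⟨hs, hst.trans ht⟩, hf t ⟨hs.trans hst, ht⟩]
      exact hζ.norm_sub_le s t hs hst ht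
    · rw [hf a (left_mem_Icc.mpr hab), ha]
    · rwa [hf b (right_mem_Icc.mpr hab)]
    · simp only [hf t ht]
  · rintro ⟨⟨f, t'⟩, ⟨⟨h1, h2, h3⟩, h4⟩, h5⟩
    simp only [Prod.mk.injEq] at h5
    obtain ⟨rfl, rfl⟩ := h5
    exact ⟨ext f, h1, h2, h3, h4, rfl⟩

end IsTrajectory

/-! ### Reparametrization by a time function. -/

theorem lipschitzWith_primitive {φ : ℝ → ℝ} {B : ℝ} (hφ : Continuous φ) (hB : ∀ x, |φ x| ≤ B)
    (s : ℝ) : LipschitzWith B.toNNReal fun t => ∫ u in s..t, φ u := by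
  have hd : ∀ t, HasDerivAt (fun t => ∫ u in s..t, φ u) (φ t) t := fun t =>
    (hφ.integral_hasStrictDerivAt s t).hasDerivAt
  refine lipschitzWith_of_nnnorm_deriv_le (fun t => (hd t).differentiableAt) fun t => ?_
  rw [(hd t).deriv, ← NNReal.coe_le_coe, coe_nnnorm]
  exact (hB t).trans (Real.le_coe_toNNReal B)

/-- Reparametrization of a Lipschitz curve by a Lipschitz time function gives a trajectory. -/
theorem exists_isTrajectory {m R : ℝ → ℝ} {B : ℝ} (hm : Continuous m) (hR : Continuous R)
    (hmB : ∀ x, |m x| ≤ B) (hRB : ∀ x, |R x| ≤ B) {ζ : ℝ → ℂ} {T : ℝ → ℝ} {a b : ℝ} (hab : a < b)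
    {K K' : NNReal} (hζ : LipschitzOnWith K ζ (Icc a b)) (hT : LipschitzOnWith K' T (Icc a b))
    (H : ∀ᵐ t : ℝ, t ∈ Icc a b → ∃ v x, HasDerivWithinAt ζ v (Icc a b) t ∧
      HasDerivWithinAt T x (Icc a b) t ∧ 0 < x ∧ ‖v - m (ζ t).im * x‖ ≤ R (ζ t).im * x) :
    StrictMonoOn T (Icc a b) ∧
      ∃ Z : ℝ → ℂ, IsTrajectory m R Z (T a) (T b) ∧ ∀ t ∈ Icc a b, Z (T t) = ζ t := by
  have hB : 0 ≤ B := (abs_nonneg _).trans (hmB 0)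
  have hsub : ∀ {s t}, s ∈ Icc a b → t ∈ Icc a b → Icc s t ⊆ Icc a b := fun hs ht =>
    Icc_subset_Icc hs.1 ht.2
  have hmono : StrictMonoOn T (Icc a b) := fun s hs t ht hst =>
    lt_of_ae_deriv_pos hst (hT.mono (hsub hs ht)) (by
      filter_upwards [H] with x hx hmem
      obtain ⟨v, y, -, h2, h3, -⟩ := hx (hsub hs ht hmem)
      exact ⟨y, h2.mono (hsub hs ht), h3⟩)
  -- `ζ` is Lipschitz relative to `T`. Hence `ζ ∘ T⁻¹` is Lipschitz although `T⁻¹` need not be.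
  have hle : ∀ {s t}, s ∈ Icc a b → t ∈ Icc a b → s ≤ t →
      ‖ζ t - ζ s‖ ≤ 2 * B * T t - 2 * B * T s := fun hs ht hst =>
    norm_sub_le_of_ae_deriv (h := fun x => 2 * B * T x) hst (hζ.mono (hsub hs ht))
      (((lipschitzWith_smul (2 * B)).comp_lipschitzOnWith (hT.mono (hsub hs ht)))) (by
      filter_upwards [H] with x hx hmem
      obtain ⟨v, y, h1, h2, h3, h4⟩ := hx (hsub hs ht hmem)
      refine ⟨v, 2 * B * y, h1.mono (hsub hs ht), (h2.mono (hsub hs ht)).const_mul _, ?_⟩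
      have h5 : ‖((m (ζ x).im : ℂ)) * y‖ ≤ B * y := by
        rw [norm_mul, Complex.norm_real, Complex.norm_real, Real.norm_of_nonneg h3.le]
        exact mul_le_mul_of_nonneg_right (hmB _) h3.le
      have h6 : R (ζ x).im * y ≤ B * y :=
        mul_le_mul_of_nonneg_right ((le_abs_self _).trans (hRB _)) h3.le
      have h7 := norm_add_le (v - m (ζ x).im * y) (m (ζ x).im * y)
      rw [sub_add_cancel] at h7
      linarith)
  have hsurj : SurjOn T (Icc a b) (Icc (T a) (T b)) :=
    intermediate_value_Icc hab.le hT.continuousOn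
  have haT : T a ≤ T b := (hmono (left_mem_Icc.mpr hab.le) (right_mem_Icc.mpr hab.le) hab).le
  let inv := Function.invFunOn T (Icc a b)
  have hinv : ∀ t ∈ Icc a b, inv (T t) = t := fun t ht => hmono.injOn.leftInvOn_invFunOn ht
  have hTmem : ∀ t ∈ Icc a b, T t ∈ Icc (T a) (T b) := fun t ht =>
    ⟨hmono.monotoneOn (left_mem_Icc.mpr hab.le) ht ht.1,
      hmono.monotoneOn ht (right_mem_Icc.mpr hab.le) ht.2⟩
  have hZ0 : ContinuousOn (fun x => ζ (inv x)) (Icc (T a) (T b)) := by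
    refine LipschitzOnWith.continuousOn (K := (2 * B).toNNReal) ?_
    refine LipschitzOnWith.of_dist_le_mul fun x hx y hy => ?_
    obtain ⟨s, hs, rfl⟩ := hsurj hx
    obtain ⟨t, ht, rfl⟩ := hsurj hy
    rw [hinv s hs, hinv t ht, Real.coe_toNNReal _ (by positivity)]
    rcases le_total s t with hst | hst
    · have h1 := hle hs ht hst
      rw [dist_comm, dist_eq_norm, dist_comm (T s), Real.dist_eq,
        abs_of_nonneg (sub_nonneg.mpr (hmono.monotoneOn hs ht hst))]
      linarith
    · have h1 := hle ht hs hst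
      rw [dist_eq_norm, Real.dist_eq,
        abs_of_nonneg (sub_nonneg.mpr (hmono.monotoneOn ht hs hst))]
      linarith
  let Z : ℝ → ℂ := fun x => ζ (inv (projIcc (T a) (T b) haT x))
  have hZ : Continuous Z := hZ0.comp_continuous (continuous_subtype_val.comp continuous_projIcc)
    fun x => (projIcc (T a) (T b) haT x).2
  have hZT : ∀ t ∈ Icc a b, Z (T t) = ζ t := fun t ht => by
    simp only [Z, projIcc_of_mem _ (hTmem t ht), hinv t ht]
  refine ⟨hmono, Z, ⟨hZ, fun x y hx hxy hy => ?_⟩, hZT⟩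
  obtain ⟨s, hs, rfl⟩ := hsurj ⟨hx, hxy.trans hy⟩
  obtain ⟨t, ht, rfl⟩ := hsurj ⟨hx.trans hxy, hy⟩
  have hst : s ≤ t := (hmono.le_iff_le hs ht).mp hxy
  have hT' := hT.mono (hsub hs ht)
  have hcont : ∀ {φ : ℝ → ℝ}, Continuous φ → Continuous fun u => φ (Z u).im := fun hφ =>
    hφ.comp (Complex.continuous_im.comp hZ)
  have hlip : ∀ {φ : ℝ → ℝ}, Continuous φ → (∀ x, |φ x| ≤ B) →
      LipschitzWith B.toNNReal fun x => ∫ u in T s..x, φ (Z u).im := fun hφ hφB =>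
    lipschitzWith_primitive (hcont hφ) (fun x => hφB _) (T s)
  have hder : ∀ {φ : ℝ → ℝ}, Continuous φ → ∀ {x y}, x ∈ Icc s t →
      HasDerivWithinAt T y (Icc s t) x →
      HasDerivWithinAt (fun x => ∫ u in T s..T x, φ (Z u).im) (φ (ζ x).im * y) (Icc s t) x := by
    intro φ hφ x y hx hy
    have := ((hcont hφ).integral_hasStrictDerivAt (T s) (T x)).hasDerivAt.comp_hasDerivWithinAt x hy
    rwa [hZT x (hsub hs ht hx)] at this
  -- No change of variables is made: the integrals up to `T x` are differentiated in `x` by the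
  -- chain rule, and the mean value inequality is applied in the original parameter.
  have key := norm_sub_le_of_ae_deriv
    (f := fun x => ζ x - ((∫ u in T s..T x, m (Z u).im : ℝ) : ℂ))
    (h := fun x => ∫ u in T s..T x, R (Z u).im) hst
    ((hζ.mono (hsub hs ht)).sub (Complex.isometry_ofReal.lipschitz.comp_lipschitzOnWith
      ((hlip hm hmB).comp_lipschitzOnWith hT')))
    ((hlip hR hRB).comp_lipschitzOnWith hT') (by
      filter_upwards [H] with x hx hmem
      obtain ⟨v, y, h1, h2, h3, h4⟩ := hx (hsub hs ht hmem)
      have h2' := h2.mono (hsub hs ht)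
      refine ⟨_, _, (h1.mono (hsub hs ht)).sub (hder hm hmem h2').ofReal_comp, hder hR hmem h2', ?_⟩
      simpa using h4)
  rw [hZT s hs, hZT t ht]
  simpa [sub_right_comm] using key

/-! ### Smoothness and positivity of the conformal factor. -/

/-- The conformal factor `ρ² sinh² ξ + ε η(|ξ|/ε)` of the smoothed metric. -/
noncomputable def confFactor (ρ ε : ℝ) (η : ℝ → ℝ) (x : ℝ) : ℝ :=
  ρ ^ 2 * Real.sinh x ^ 2 + ε * η (|x| / ε)

section confFactor

variable {ρ ε : ℝ} {η : ℝ → ℝ}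

/-- The kink of `|x|` at `0` is harmless, since `η` is constant near `0`. -/
theorem contDiff_confFactor (ρ : ℝ) (hε : 0 < ε) (hη : IsBump η) :
    ContDiff ℝ ∞ (confFactor ρ ε η) := by
  refine (contDiff_const.mul (Real.contDiff_sinh.pow 2)).add (contDiff_const.mul ?_)
  rw [contDiff_iff_contDiffAt]
  intro x
  rcases eq_or_ne x 0 with rfl | hx
  · refine (contDiffAt_const (c := (1 : ℝ))).congr_of_eventuallyEq ?_
    filter_upwards [Metric.ball_mem_nhds (0 : ℝ) (half_pos hε)] with y hy
    rw [mem_ball_zero_iff, Real.norm_eq_abs] at hy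
    refine hη.eq_one _ ⟨by positivity, ?_⟩
    rw [div_le_iff₀ hε]
    linarith
  · have h1 : ContDiffAt ℝ ∞ η (|x| / ε) :=
      hη.smooth.contDiffAt (Ici_mem_nhds (by positivity))
    have h2 : ContDiffAt ℝ ∞ (fun y : ℝ => |y| / ε) x := (contDiffAt_abs hx).div_const ε
    exact h1.comp x h2

/-- For `|x| ≤ ε/2` the bump term is exactly `ε`; elsewhere the `sinh` term is at least its value at
`ε/2`. Without the bump the factor would vanish on the CTC surface and the velocity discs would be
unbounded. -/
theorem exists_pos_le_confFactor (hρ : ρ ≠ 0) (hε : 0 < ε) (hη : IsBump η) :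
    ∃ c, 0 < c ∧ ∀ x, c ≤ confFactor ρ ε η x := by
  have hη0 : ∀ x : ℝ, 0 ≤ ε * η (|x| / ε) := fun x =>
    mul_nonneg hε.le (hη.mapsTo (mem_Ici.mpr (by positivity))).1
  have hs : 0 < Real.sinh (ε / 2) := Real.sinh_pos_iff.mpr (half_pos hε)
  refine ⟨min ε (ρ ^ 2 * Real.sinh (ε / 2) ^ 2), by positivity, fun x => ?_⟩
  rcases le_total |x| (ε / 2) with hx | hx
  · have : η (|x| / ε) = 1 := hη.eq_one _ ⟨by positivity, by rw [div_le_iff₀ hε]; linarith⟩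
    rw [confFactor, this]
    have : 0 ≤ ρ ^ 2 * Real.sinh x ^ 2 := by positivity
    linarith [min_le_left ε (ρ ^ 2 * Real.sinh (ε / 2) ^ 2)]
  · have h1 : Real.sinh (ε / 2) ≤ |Real.sinh x| := by
      rw [Real.abs_sinh]; exact Real.sinh_le_sinh.mpr hx
    have h2 : Real.sinh (ε / 2) ^ 2 ≤ Real.sinh x ^ 2 := by
      rw [← sq_abs (Real.sinh x)]; exact pow_le_pow_left₀ hs.le h1 2
    have h3 := mul_le_mul_of_nonneg_left h2 (sq_nonneg ρ)
    rw [confFactor]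
    linarith [min_le_right ε (ρ ^ 2 * Real.sinh (ε / 2) ^ 2), hη0 x]

end confFactor

theorem smoothedMetric_apply (θ σ : ℝ) (η : ℝ → ℝ) (ε : ℝ) (p : DoubledRegion) (v : Coord) :
    smoothedMetric θ σ η ε p v = -(1 / θ ^ 2 * (v.2.1 * v.2.1)) - σ / θ / Real.pi * (v.1 * v.2.1) +
      confFactor (σ / θ) ε η p.2.2 *
        ((θ / (2 * Real.pi)) ^ 2 * (v.1 * v.1) + v.2.2 * v.2.2) := by
  simp [smoothedMetric, confFactor, dAlpha, dTau, dXi, mul_add]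

/-! ### The disc of causal velocities. -/

/-- Centre of the disc of future-directed causal velocities, with respect to `τ / θ`, in the plane
with coordinates `θ α / 2π` and `ξ`. -/
noncomputable def discCentre (ρ : ℝ) (F : ℝ → ℝ) (x : ℝ) : ℝ := ρ / F x

/-- Radius of the disc of future-directed causal velocities; see `discCentre`. -/
noncomputable def discRadius (ρ : ℝ) (F : ℝ → ℝ) (x : ℝ) : ℝ := √(1 / F x + (ρ / F x) ^ 2)

section disc

variable {ρ : ℝ} {F : ℝ → ℝ} {c : ℝ}

theorem continuous_discCentre (hF : Continuous F) (h0 : ∀ x, 0 < F x) :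
    Continuous (discCentre ρ F) :=
  continuous_const.div hF fun x => (h0 x).ne'

theorem continuous_discRadius (hF : Continuous F) (h0 : ∀ x, 0 < F x) :
    Continuous (discRadius ρ F) :=
  Real.continuous_sqrt.comp ((continuous_const.div hF fun x => (h0 x).ne').add
    ((continuous_discCentre hF h0).pow 2))

/-- Puts `0` in every disc: `∂_τ` is causal. -/
theorem abs_discCentre_le_discRadius (h0 : ∀ x, 0 < F x) (x : ℝ) :
    |discCentre ρ F x| ≤ discRadius ρ F x := by
  have := h0 x
  refine Real.le_sqrt_of_sq_le ?_
  rw [discCentre, sq_abs]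
  linarith [one_div_pos.mpr this]

theorem abs_discRadius_le (hc : 0 < c) (hcF : ∀ x, c ≤ F x) (x : ℝ) :
    |discRadius ρ F x| ≤ √(1 / c + ρ ^ 2 / c ^ 2) := by
  rw [discRadius, abs_of_nonneg (Real.sqrt_nonneg _), div_pow]
  have h := hcF x
  gcongr

theorem abs_discCentre_le (hc : 0 < c) (hcF : ∀ x, c ≤ F x) (x : ℝ) :
    |discCentre ρ F x| ≤ √(1 / c + ρ ^ 2 / c ^ 2) :=
  (abs_discCentre_le_discRadius (fun x => hc.trans_le (hcF x)) x).trans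
    ((le_abs_self _).trans (abs_discRadius_le hc hcF x))

/-- The causal condition is membership in a disc. -/
theorem norm_sub_le_discRadius_iff (h0 : ∀ x, 0 < F x) {x : ℝ} {z : ℂ} {T : ℝ} (hT : 0 ≤ T) :
    ‖z - discCentre ρ F x * T‖ ≤ discRadius ρ F x * T ↔
      F x * (z.re ^ 2 + z.im ^ 2) ≤ T ^ 2 + 2 * ρ * z.re * T := by
  have hF := h0 x
  have hR : 0 ≤ 1 / F x + (ρ / F x) ^ 2 := by positivity
  rw [discRadius, ← sq_le_sq₀ (norm_nonneg _) (by positivity), mul_pow, Real.sq_sqrt hR,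
    ← Complex.normSq_eq_norm_sq, Complex.normSq_apply, ← Complex.ofReal_mul, Complex.sub_re,
    Complex.sub_im, Complex.ofReal_re, Complex.ofReal_im, discCentre]
  have e : (1 / F x + (ρ / F x) ^ 2) * T ^ 2 - ((z.re - ρ / F x * T) * (z.re - ρ / F x * T)
      + (z.im - 0) * (z.im - 0)) =
      (F x)⁻¹ * (T ^ 2 + 2 * ρ * z.re * T - F x * (z.re ^ 2 + z.im ^ 2)) := by
    field_simp
    ring
  rw [← sub_nonneg, e, mul_nonneg_iff_of_pos_left (inv_pos.mpr hF), sub_nonneg]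

end disc

/-! ### Adapted coordinates, causal vectors and the signature. -/

/-- The map `(α, τ, ξ) ↦ θ α / 2π + i ξ`. -/
noncomputable def planeCoord (θ : ℝ) : Coord →L[ℝ] ℂ :=
  Complex.equivRealProdCLM.symm.toContinuousLinearMap.comp
    (((θ / (2 * Real.pi)) • ContinuousLinearMap.fst ℝ ℝ (ℝ × ℝ)).prod
      ((ContinuousLinearMap.snd ℝ ℝ ℝ).comp (ContinuousLinearMap.snd ℝ ℝ (ℝ × ℝ))))

/-- The map `(α, τ, ξ) ↦ τ / θ`. -/
noncomputable def timeCoord (θ : ℝ) : Coord →L[ℝ] ℝ :=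
  (1 / θ) • (ContinuousLinearMap.fst ℝ ℝ ℝ).comp (ContinuousLinearMap.snd ℝ ℝ (ℝ × ℝ))

/-- The point with given `timeCoord` and `planeCoord`. -/
noncomputable def ofTimePlane (θ : ℝ) : ℝ × ℂ →L[ℝ] Coord :=
  ((2 * Real.pi / θ) • Complex.reCLM.comp (ContinuousLinearMap.snd ℝ ℝ ℂ)).prod
    ((θ • ContinuousLinearMap.fst ℝ ℝ ℂ).prod
      (Complex.imCLM.comp (ContinuousLinearMap.snd ℝ ℝ ℂ)))

theorem ofTimePlane_apply (θ : ℝ) (q : ℝ × ℂ) :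
    ofTimePlane θ q = (2 * Real.pi / θ * q.2.re, θ * q.1, q.2.im) := rfl

@[simp] theorem planeCoord_re (θ : ℝ) (x : Coord) :
    (planeCoord θ x).re = θ / (2 * Real.pi) * x.1 := rfl

@[simp] theorem planeCoord_im (θ : ℝ) (x : Coord) : (planeCoord θ x).im = x.2.2 := rfl

@[simp] theorem timeCoord_apply (θ : ℝ) (x : Coord) : timeCoord θ x = x.2.1 / θ := by
  simp [timeCoord, div_eq_inv_mul]

theorem ofTimePlane_coord {θ : ℝ} (hθ : θ ≠ 0) (x : Coord) :
    ofTimePlane θ (timeCoord θ x, planeCoord θ x) = x := by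
  have := Real.pi_ne_zero
  ext <;> simp [ofTimePlane_apply] <;> field_simp

theorem timeCoord_ofTimePlane {θ : ℝ} (hθ : θ ≠ 0) (q : ℝ × ℂ) :
    timeCoord θ (ofTimePlane θ q) = q.1 := by
  simp [ofTimePlane_apply]; field_simp

theorem planeCoord_ofTimePlane {θ : ℝ} (hθ : θ ≠ 0) (q : ℝ × ℂ) :
    planeCoord θ (ofTimePlane θ q) = q.2 := by
  have := Real.pi_ne_zero
  apply Complex.ext <;> simp [ofTimePlane_apply]; field_simp

section metric

variable {θ σ ε : ℝ} {η : ℝ → ℝ}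

theorem isFutureCausal_iff (hθ : 0 < θ) (h0 : ∀ x, 0 < confFactor (σ / θ) ε η x)
    (p : DoubledRegion) (v : Coord) :
    IsFutureCausal (smoothedMetric θ σ η ε) p v ↔ 0 < timeCoord θ v ∧
      ‖planeCoord θ v - discCentre (σ / θ) (confFactor (σ / θ) ε η) p.2.2 * timeCoord θ v‖ ≤
        discRadius (σ / θ) (confFactor (σ / θ) ε η) p.2.2 * timeCoord θ v := by
  set ρ := σ / θ with hρ
  set F := confFactor ρ ε η with hF
  have hFp := h0 p.2.2
  set w := (planeCoord θ v).re with hw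
  set z := (planeCoord θ v).im with hz
  set T := timeCoord θ v with hT
  have hpi := Real.pi_pos
  have e1 : v.2.1 = θ * T := by rw [hT, timeCoord_apply]; field_simp
  have e2 : v.1 = 2 * Real.pi / θ * w := by rw [hw, planeCoord_re]; field_simp
  have e3 : v.2.2 = z := by rw [hz, planeCoord_im]
  have hg : smoothedMetric θ σ η ε p v = F p.2.2 * (w ^ 2 + z ^ 2) - (T ^ 2 + 2 * ρ * w * T) := by
    rw [smoothedMetric_apply, e1, e2, e3, ← hρ, ← hF]
    field_simp
    ring
  have hpolar : QuadraticMap.polar (smoothedMetric θ σ η ε p) v partialTau =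
      -(2 / θ) * (T + ρ * w) := by
    rw [QuadraticMap.polar]
    simp only [smoothedMetric_apply, partialTau, Prod.fst_add, Prod.snd_add, e1, e2, e3, ← hρ]
    field_simp
    ring
  have hv0 : v = 0 → T = 0 := fun h => by rw [hT, h, map_zero]
  rw [IsFutureCausal, hg, hpolar, sub_nonpos, neg_mul, neg_lt_zero,
    mul_pos_iff_of_pos_left (by positivity)]
  constructor
  · rintro ⟨-, h1, h2⟩
    have hT0 : 0 < T := by
      -- The causal inequality reads `F (w² + z²) ≤ T (T + 2ρw)`. With `T ≤ 0 < T + ρw` the right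
      -- side is nonpositive, while the left is positive.
      by_contra hcon
      push Not at hcon
      have h3 : 0 < ρ * w := by linarith
      have h4 : w ≠ 0 := by rintro h; simp [h] at h3
      have h5 : 0 < F p.2.2 * (w ^ 2 + z ^ 2) := by positivity
      nlinarith
    exact ⟨hT0, (norm_sub_le_discRadius_iff h0 hT0.le).mpr h1⟩
  · rintro ⟨hT0, h1⟩
    have h1 := (norm_sub_le_discRadius_iff h0 hT0.le).mp h1
    refine ⟨fun h => hT0.ne' (hv0 h), h1, ?_⟩
    -- With `T + ρw ≤ 0 < T`, the factor `T + 2ρw` is negative and so is `T (T + 2ρw)`.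
    by_contra hcon
    have h5 : 0 ≤ F p.2.2 * (w ^ 2 + z ^ 2) := by positivity
    nlinarith

/-- Completing the square gives `-(T + ρw)² + (F + ρ²) w² + F z²`. -/
theorem lorentzian_smoothedMetric (hθ : 0 < θ) (h0 : ∀ x, 0 < confFactor (σ / θ) ε η x)
    (p : DoubledRegion) : (smoothedMetric θ σ η ε p).Equivalent
      (QuadraticMap.weightedSumSquares ℝ (![-1, 1, 1] : Fin 3 → ℝ)) := by
  have hF := h0 p.2.2
  have hpi := Real.pi_pos
  set ρ := σ / θ with hρ
  set f := confFactor ρ ε η p.2.2 with hf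
  have hA : 0 < √(f + ρ ^ 2) := Real.sqrt_pos.mpr (by positivity)
  have hB : 0 < √f := Real.sqrt_pos.mpr hF
  have hA2 : √(f + ρ ^ 2) ^ 2 = f + ρ ^ 2 := Real.sq_sqrt (by positivity)
  have hB2 : √f ^ 2 = f := Real.sq_sqrt hF.le
  set A := √(f + ρ ^ 2)
  set B := √f
  let e : Coord ≃ₗ[ℝ] (Fin 3 → ℝ) :=
    { toFun := fun v => ![v.2.1 / θ + ρ * (θ / (2 * Real.pi) * v.1),
        A * (θ / (2 * Real.pi) * v.1), B * v.2.2]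
      map_add' := fun v w => by
        ext i
        fin_cases i <;> simp <;> ring
      map_smul' := fun k v => by
        ext i
        fin_cases i <;> simp <;> ring
      invFun := fun y => (2 * Real.pi / θ * (y 1 / A), θ * (y 0 - ρ * (y 1 / A)), y 2 / B)
      left_inv := fun v => by
        ext <;> simp <;> field_simp
        ring
      right_inv := fun y => by
        ext i
        fin_cases i <;> simp <;> field_simp
        ring }
  refine ⟨{ e with map_app' := fun v => ?_ }⟩
  rw [smoothedMetric_apply, QuadraticMap.weightedSumSquares_apply, Fin.sum_univ_three, ← hρ, ← hf]
  change -1 * ((v.2.1 / θ + ρ * (θ / (2 * Real.pi) * v.1)) *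
      (v.2.1 / θ + ρ * (θ / (2 * Real.pi) * v.1))) +
    1 * (A * (θ / (2 * Real.pi) * v.1) * (A * (θ / (2 * Real.pi) * v.1))) +
    1 * (B * v.2.2 * (B * v.2.2)) = _
  have e1 : ∀ y : ℝ, A * y * (A * y) = (f + ρ ^ 2) * y ^ 2 := fun y => by rw [← hA2]; ring
  have e2 : ∀ y : ℝ, B * y * (B * y) = f * y ^ 2 := fun y => by
    calc B * y * (B * y) = B ^ 2 * y ^ 2 := by ring
      _ = f * y ^ 2 := by rw [hB2]
  rw [e1, e2]
  field_simp
  ring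

theorem isSpacetime_smoothedMetric (hθ : 0 < θ) (hσ : σ ≠ 0) (hε : 0 < ε) (hη : IsBump η) :
    IsSpacetime (smoothedMetric θ σ η ε) := by
  obtain ⟨c, hc, hcF⟩ := exists_pos_le_confFactor (div_ne_zero hσ hθ.ne') hε hη
  refine ⟨fun v => ?_, lorentzian_smoothedMetric hθ fun x => hc.trans_le (hcF x), fun p => ?_⟩
  · simp only [smoothedMetric_apply, proj]
    have h := contDiff_confFactor (σ / θ) hε hη
    exact contDiff_const.add ((h.comp (contDiff_snd.comp contDiff_snd)).mul contDiff_const)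
  · rw [smoothedMetric_apply]
    simp only [partialTau]
    have : 0 < 1 / θ ^ 2 := by positivity
    linarith

theorem isSpacelikeSurface_tau_eq (hθ : 0 < θ) (h0 : ∀ x, 0 < confFactor (σ / θ) ε η x) (a : ℝ) :
    IsSpacelikeSurface (smoothedMetric θ σ η ε) {p | tau p = a} := by
  intro x _
  let L : Coord →L[ℝ] ℝ :=
    (ContinuousLinearMap.fst ℝ ℝ ℝ).comp (ContinuousLinearMap.snd ℝ ℝ (ℝ × ℝ))
  have hL : fderiv ℝ (fun y : Coord => L y - a) x = L := by
    rw [fderiv_sub_const]; exact L.fderiv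
  refine ⟨univ, univ_mem, fun y => L y - a, L.contDiff.sub contDiff_const, ?_, fun y _ => ?_,
    fun v hv hv0 => ?_⟩
  · rw [hL]
    intro h
    have : L partialTau = 0 := by rw [h]; rfl
    simp [L, partialTau] at this
  · exact sub_eq_zero.symm
  · rw [hL] at hv0
    have hv0 : v.2.1 = 0 := hv0
    rw [smoothedMetric_apply, hv0]
    have hpi := Real.pi_pos
    have h1 : 0 < (θ / (2 * Real.pi)) ^ 2 * (v.1 * v.1) + v.2.2 * v.2.2 := by
      by_cases h : v.1 = 0
      · have : v.2.2 ≠ 0 := fun h' => hv (by ext <;> simp [h, h', hv0])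
        have := mul_self_pos.mpr this
        positivity
      · have := mul_self_pos.mpr h
        have := mul_self_nonneg v.2.2
        positivity
    have := mul_pos (h0 (proj x).2.2) h1
    linarith

end metric

/-! ### The covering and its deck transformations. -/

theorem lipschitzWith_proj : LipschitzWith 1 proj := by
  refine LipschitzWith.of_dist_le_mul fun x y => ?_
  rw [NNReal.coe_one, one_mul]
  refine max_le_max ?_ le_rfl
  rw [dist_eq_norm, dist_eq_norm]
  exact QuotientAddGroup.norm_mk_le_norm (m := x.1 - y.1)

/-- The point of the doubled region with given `timeCoord` and `planeCoord`. -/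
noncomputable def planePoint (θ : ℝ) (q : ℝ × ℂ) : DoubledRegion := proj (ofTimePlane θ q)

theorem lipschitzWith_planePoint (θ : ℝ) : LipschitzWith ‖ofTimePlane θ‖₊ (planePoint θ) := by
  refine LipschitzWith.of_dist_le_mul fun x y => ?_
  have h := lipschitzWith_proj.dist_le_mul (ofTimePlane θ x) (ofTimePlane θ y)
  rw [NNReal.coe_one, one_mul] at h
  exact h.trans ((ofTimePlane θ).lipschitz.dist_le_mul x y)

theorem tau_planePoint {θ : ℝ} (hθ : θ ≠ 0) (q : ℝ × ℂ) : tau (planePoint θ q) / θ = q.1 :=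
  mul_div_cancel_left₀ q.1 hθ

theorem exists_planePoint_eq {θ : ℝ} (hθ : θ ≠ 0) (p : DoubledRegion) :
    ∃ z, planePoint θ (tau p / θ, z) = p := by
  obtain ⟨α, hα⟩ := QuotientAddGroup.mk_surjective p.1
  refine ⟨planeCoord θ (α, p.2), ?_⟩
  have h := ofTimePlane_coord hθ (α, p.2)
  rw [timeCoord_apply] at h
  rw [planePoint, tau, h]
  exact Prod.ext hα rfl

/-- Two points of the plane over the same point differ by a deck transformation. -/
theorem exists_deck {θ : ℝ} {t : ℝ} {z w : ℂ}
    (h : planePoint θ (t, z) = planePoint θ (t, w)) :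
    ∃ k : ℝ, z = w + k ∧ ∀ s y, planePoint θ (s, y + k) = planePoint θ (s, y) := by
  have h1 : ((2 * Real.pi / θ * z.re : ℝ) : AddCircle (2 * Real.pi)) =
      (2 * Real.pi / θ * w.re : ℝ) := congrArg Prod.fst h
  have h2 : z.im = w.im := congrArg (fun p => p.2.2) h
  rw [← sub_eq_zero, ← AddCircle.coe_sub, AddCircle.coe_eq_zero_iff] at h1
  obtain ⟨n, hn⟩ := h1
  have hk : 2 * Real.pi / θ * (z.re - w.re) = n • (2 * Real.pi) := by rw [hn]; ring
  refine ⟨z.re - w.re, Complex.ext (by simp) (by simp [h2]), fun s y => ?_⟩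
  refine Prod.ext ?_ (Prod.ext rfl ?_)
  · change ((2 * Real.pi / θ * (y + ((z.re - w.re : ℝ) : ℂ)).re : ℝ) : AddCircle (2 * Real.pi)) =
      (2 * Real.pi / θ * y.re : ℝ)
    rw [Complex.add_re, Complex.ofReal_re, mul_add, hk, AddCircle.coe_add,
      (AddCircle.coe_eq_zero_iff _).mpr ⟨n, rfl⟩, add_zero]
  · change (y + ((z.re - w.re : ℝ) : ℂ)).im = y.im
    simp

theorem IsCausalCurveOn.mono {g : MetricField} {γ : ℝ → DoubledRegion} {I J : Set ℝ}
    (h : IsCausalCurveOn g γ I) (hJ : J ⊆ I) : IsCausalCurveOn g γ J := by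
  refine ⟨h.1.mono hJ, ?_⟩
  filter_upwards [h.2] with t ht hmem
  obtain ⟨v, ⟨c, h1, h2⟩, hv⟩ := ht (hJ hmem)
  exact ⟨v, ⟨c, h1.filter_mono (nhdsWithin_mono t hJ), h2.mono hJ⟩, hv⟩

/-! ### Causal curves as trajectories, causal diamonds, strong causality. -/

section metric

variable {θ σ ε c : ℝ} {η : ℝ → ℝ}

local notation "ctr" => discCentre (σ / θ) (confFactor (σ / θ) ε η)
local notation "rad" => discRadius (σ / θ) (confFactor (σ / θ) ε η)

/-- Causal curves, parametrized by `τ / θ`, are trajectories. -/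
theorem IsCausalCurveOn.exists_isTrajectory (hθ : 0 < θ) (hF : Continuous (confFactor (σ / θ) ε η))
    (hc : 0 < c) (hcF : ∀ x, c ≤ confFactor (σ / θ) ε η x) {γ : ℝ → DoubledRegion} {a b : ℝ}
    (hab : a < b) (hγ : IsCausalCurveOn (smoothedMetric θ σ η ε) γ (Icc a b)) :
    StrictMonoOn (fun t => tau (γ t) / θ) (Icc a b) ∧
      ∃ Z : ℝ → ℂ, IsTrajectory ctr rad Z (tau (γ a) / θ) (tau (γ b) / θ) ∧
        ∀ t ∈ Icc a b, planePoint θ (tau (γ t) / θ, Z (tau (γ t) / θ)) = γ t := by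
  have h0 : ∀ x, 0 < confFactor (σ / θ) ε η x := fun x => hc.trans_le (hcF x)
  obtain ⟨x, K, hx, hproj, hder⟩ := hγ.exists_lift hab
  have hT : ∀ t ∈ Icc a b, timeCoord θ (x t) = tau (γ t) / θ := fun t ht => by
    rw [timeCoord_apply, ← hproj t ht]; rfl
  have hTL : LipschitzOnWith (‖timeCoord θ‖₊ * K) (fun t => tau (γ t) / θ) (Icc a b) := by
    refine LipschitzOnWith.of_dist_le_mul fun s hs t ht => ?_
    have h := ((timeCoord θ).lipschitz.comp_lipschitzOnWith hx).dist_le_mul s hs t ht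
    rwa [Function.comp_apply, Function.comp_apply, hT s hs, hT t ht] at h
  have hζL : LipschitzOnWith (‖planeCoord θ‖₊ * K) (fun t => planeCoord θ (x t)) (Icc a b) :=
    (planeCoord θ).lipschitz.comp_lipschitzOnWith hx
  obtain ⟨h1, Z, h2, h3⟩ := SpinParticle.exists_isTrajectory (continuous_discCentre hF h0)
    (continuous_discRadius hF h0) (abs_discCentre_le hc hcF) (abs_discRadius_le hc hcF) hab
    hζL hTL (by
      filter_upwards [hder] with t ht hmem
      obtain ⟨v, hv, hcausal⟩ := ht hmem
      have hv₁ : HasDerivWithinAt (fun s => planeCoord θ (x s)) (planeCoord θ v) (Icc a b) t :=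
        (planeCoord θ).hasFDerivAt.comp_hasDerivWithinAt t hv
      have hv₂ : HasDerivWithinAt (fun s => timeCoord θ (x s)) (timeCoord θ v) (Icc a b) t :=
        (timeCoord θ).hasFDerivAt.comp_hasDerivWithinAt t hv
      refine ⟨planeCoord θ v, timeCoord θ v, hv₁,
        hv₂.congr (fun s hs => (hT s hs).symm) (hT t hmem).symm, ?_⟩
      have h := (isFutureCausal_iff hθ h0 _ _).mp hcausal
      rwa [show (proj (x t)).2.2 = (planeCoord θ (x t)).im from rfl] at h)
  refine ⟨h1, Z, h2, fun t ht => ?_⟩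
  rw [h3 t ht, ← hT t ht, planePoint, ofTimePlane_coord hθ.ne', hproj t ht]

theorem IsTrajectory.isCausalCurveOn (hθ : 0 < θ) (hF : Continuous (confFactor (σ / θ) ε η))
    (hc : 0 < c) (hcF : ∀ x, c ≤ confFactor (σ / θ) ε η x) {Z : ℝ → ℂ} {a b : ℝ}
    (hZ : IsTrajectory ctr rad Z a b) :
    IsCausalCurveOn (smoothedMetric θ σ η ε) (fun t => planePoint θ (t, Z t)) (Icc a b) := by
  have h0 : ∀ x, 0 < confFactor (σ / θ) ε η x := fun x => hc.trans_le (hcF x)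
  have hL := hZ.lipschitzOnWith (abs_discCentre_le hc hcF) (abs_discRadius_le hc hcF)
  refine ⟨fun t _ => ⟨_, Icc a b, self_mem_nhdsWithin,
    (lipschitzWith_planePoint θ).comp_lipschitzOnWith
      ((LipschitzWith.id.lipschitzOnWith (s := Icc a b)).prodMk hL)⟩, ?_⟩
  filter_upwards [hZ.ae_hasDerivWithinAt (continuous_discCentre hF h0)
    (continuous_discRadius hF h0) (abs_discCentre_le hc hcF) (abs_discRadius_le hc hcF)]
    with t ht hmem
  obtain ⟨v, hv, hle⟩ := ht hmem
  -- The parameter is `τ / θ` itself, so the time component of the velocity is `1`.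
  refine ⟨ofTimePlane θ (1, v), ⟨fun s => ofTimePlane θ (s, Z s), Eventually.of_forall fun _ => rfl,
    (ofTimePlane θ).hasFDerivAt.comp_hasDerivWithinAt t ((hasDerivWithinAt_id t _).prodMk hv)⟩, ?_⟩
  rw [isFutureCausal_iff hθ h0, timeCoord_ofTimePlane hθ.ne', planeCoord_ofTimePlane hθ.ne']
  rw [show (planePoint θ (t, Z t)).2.2 = (Z t).im from rfl]
  exact ⟨one_pos, by simpa using hle⟩

theorem IsCausalCurveOn.dist_le (hθ : 0 < θ) (hF : Continuous (confFactor (σ / θ) ε η))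
    (hc : 0 < c) (hcF : ∀ x, c ≤ confFactor (σ / θ) ε η x) :
    ∃ C, 0 ≤ C ∧ ∀ {γ : ℝ → DoubledRegion} {a b : ℝ}, a < b →
      IsCausalCurveOn (smoothedMetric θ σ η ε) γ (Icc a b) →
        StrictMonoOn (fun t => tau (γ t)) (Icc a b) ∧
        dist (γ a) (γ b) ≤ C * |tau (γ a) - tau (γ b)| := by
  -- In the sup metric the pair (time, plane point) moves at rate at most `max 1 (2B)` per unit of
  -- `τ / θ`; dividing by `θ` converts to `τ`.
  refine ⟨‖ofTimePlane θ‖ * (max 1 (2 * √(1 / c + (σ / θ) ^ 2 / c ^ 2)) / θ), by positivity,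
    fun {γ a b} hab hγ => ?_⟩
  obtain ⟨h1, Z, h2, h3⟩ := hγ.exists_isTrajectory hθ hF hc hcF hab
  have hmono : StrictMonoOn (fun t => tau (γ t)) (Icc a b) := fun s hs t ht hst =>
    (div_lt_div_iff_of_pos_right hθ).mp (h1 hs ht hst)
  refine ⟨hmono, ?_⟩
  have ha := left_mem_Icc.mpr hab.le
  have hb := right_mem_Icc.mpr hab.le
  have hle := (h1 ha hb hab).le
  have hL := h2.lipschitzOnWith (abs_discCentre_le hc hcF) (abs_discRadius_le hc hcF)
  have hd := hL.dist_le_mul _ (left_mem_Icc.mpr hle) _ (right_mem_Icc.mpr hle)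
  rw [Real.coe_toNNReal _ (by positivity)] at hd
  have hp := (lipschitzWith_planePoint θ).dist_le_mul (tau (γ a) / θ, Z (tau (γ a) / θ))
    (tau (γ b) / θ, Z (tau (γ b) / θ))
  rw [h3 a ha, h3 b hb, coe_nnnorm] at hp
  have he : dist (tau (γ a) / θ) (tau (γ b) / θ) = |tau (γ a) - tau (γ b)| / θ := by
    rw [Real.dist_eq, ← sub_div, abs_div, abs_of_pos hθ]
  refine hp.trans ?_
  rw [mul_assoc]
  refine mul_le_mul_of_nonneg_left ?_ (norm_nonneg _)
  rw [div_mul_eq_mul_div, mul_div_assoc, ← he]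
  refine max_le ?_ (hd.trans ?_)
  · exact le_mul_of_one_le_left dist_nonneg (le_max_left _ _)
  · exact mul_le_mul_of_nonneg_right (le_max_right _ _) dist_nonneg

theorem mem_causalFuture_iff (hθ : 0 < θ) (hF : Continuous (confFactor (σ / θ) ε η))
    (hc : 0 < c) (hcF : ∀ x, c ≤ confFactor (σ / θ) ε η x) {p q : DoubledRegion} :
    q ∈ causalFuture (smoothedMetric θ σ η ε) p ↔ tau p / θ ≤ tau q / θ ∧
      ∃ Z : ℝ → ℂ, IsTrajectory ctr rad Z (tau p / θ) (tau q / θ) ∧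
        planePoint θ (tau p / θ, Z (tau p / θ)) = p ∧
        planePoint θ (tau q / θ, Z (tau q / θ)) = q := by
  constructor
  · rintro (rfl | ⟨a, b, γ, hab, hγ, rfl, rfl⟩)
    · obtain ⟨z, hz⟩ := exists_planePoint_eq hθ.ne' q
      exact ⟨le_rfl, fun _ => z, IsTrajectory.const
        (abs_discCentre_le_discRadius fun x => hc.trans_le (hcF x)) z _ _, hz, hz⟩
    · obtain ⟨h1, Z, h2, h3⟩ := hγ.exists_isTrajectory hθ hF hc hcF hab
      have ha := left_mem_Icc.mpr hab.le
      have hb := right_mem_Icc.mpr hab.le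
      exact ⟨(h1 ha hb hab).le, Z, h2, h3 a ha, h3 b hb⟩
  · rintro ⟨hle, Z, hZ, hp, hq⟩
    rcases hle.eq_or_lt with heq | hlt
    · left
      rw [← hp, ← hq, heq]
    · exact .inr ⟨_, _, _, hlt, hZ.isCausalCurveOn hθ hF hc hcF, hp, hq⟩

theorem isCompact_causalDiamond (hθ : 0 < θ) (hF : Continuous (confFactor (σ / θ) ε η))
    (hc : 0 < c) (hcF : ∀ x, c ≤ confFactor (σ / θ) ε η x) (p q : DoubledRegion) :
    IsCompact (causalFuture (smoothedMetric θ σ η ε) p ∩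
      causalPast (smoothedMetric θ σ η ε) q) := by
  have h0 : ∀ x, 0 < confFactor (σ / θ) ε η x := fun x => hc.trans_le (hcF x)
  have hm := continuous_discCentre (ρ := σ / θ) hF h0
  have hR := continuous_discRadius (ρ := σ / θ) hF h0
  have hcont : Continuous (planePoint θ) := (lipschitzWith_planePoint θ).continuous
  obtain ⟨z, hz⟩ := exists_planePoint_eq hθ.ne' p
  -- All lifts of `q` are admitted as end points, since the lifted curve through a point of the
  -- diamond may end at any of them.
  have hE : IsClosed {w : ℂ | planePoint θ (tau q / θ, w) = q} :=
    isClosed_eq (hcont.comp (continuous_const.prodMk continuous_id)) continuous_const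
  convert! (IsTrajectory.isCompact_setOf hm hR (abs_discCentre_le hc hcF)
    (abs_discRadius_le hc hcF) (tau p / θ) (tau q / θ) z hE).image hcont using 1
  ext x
  simp only [causalPast, mem_inter_iff, mem_ofPred_eq, mem_causalFuture_iff hθ hF hc hcF, mem_image]
  constructor
  · rintro ⟨⟨hpx, Z₁, hZ₁, hp, hx₁⟩, hxq, Z₂, hZ₂, hx₂, hq⟩
    -- `k₁` moves the start of the first lift to the fixed lift `z` of `p`; `k₂` moves the second
    -- lift so that it continues the first.
    obtain ⟨k₁, hk₁, hdeck₁⟩ := exists_deck (hz.trans hp.symm)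
    obtain ⟨k₂, hk₂, hdeck₂⟩ := exists_deck ((hdeck₁ _ _).trans (hx₁.trans hx₂.symm))
    refine ⟨(tau x / θ, Z₁ (tau x / θ) + k₁),
      ⟨_, (hZ₁.add_real k₁).trans hm hR (hZ₂.add_real k₂) hk₂, ?_, ?_, ⟨hpx, hxq⟩, ?_⟩,
      (hdeck₁ _ _).trans hx₁⟩
    · rw [if_pos hpx, hk₁]
    · split_ifs with h
      · have e := le_antisymm hxq h
        rw [← e, hk₂, hdeck₂, e, hq]
      · rw [hdeck₂, hq]
    · exact (if_pos le_rfl).symm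
  · rintro ⟨⟨t, w⟩, ⟨Z, hZ, ha, hb, ht, hw⟩, rfl⟩
    obtain rfl : w = Z t := hw
    rw [tau_planePoint hθ.ne']
    exact ⟨⟨ht.1, Z, hZ.mono le_rfl ht.2, by rw [ha, hz], rfl⟩,
      ht.2, Z, hZ.mono ht.1 le_rfl, rfl, hb⟩

theorem abs_tau_sub_le_dist (p q : DoubledRegion) : |tau p - tau q| ≤ dist p q :=
  (le_max_left _ _).trans (le_max_right _ _)

theorem isStronglyCausal_smoothedMetric (hθ : 0 < θ) (hF : Continuous (confFactor (σ / θ) ε η))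
    (hc : 0 < c) (hcF : ∀ x, c ≤ confFactor (σ / θ) ε η x) :
    IsStronglyCausal (smoothedMetric θ σ η ε) := by
  obtain ⟨C, hC, hdist⟩ := IsCausalCurveOn.dist_le (σ := σ) hθ hF hc hcF
  intro p U hU
  obtain ⟨r, hr, hrU⟩ := Metric.mem_nhds_iff.mp hU
  have hδ : 0 < r / (2 * C + 1) := by positivity
  have hδr : r / (2 * C + 1) ≤ r := div_le_self hr.le (by linarith)
  refine ⟨Metric.ball p (r / (2 * C + 1)), Metric.ball_mem_nhds p hδ,
    -- With `δ = r / (2C + 1)`, end points within `δ` of `p` let `τ` vary by at most `2δ`, so the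
    -- curve stays within `2Cδ + δ = r` of `p`.
    (Metric.ball_subset_ball hδr).trans hrU, fun a b γ hab hγ ha hb t ht => hrU ?_⟩
  rw [Metric.mem_ball] at ha hb ⊢
  rcases ht.1.eq_or_lt with rfl | hat
  · exact ha.trans_le hδr
  have hmono := (hdist hab hγ).1.monotoneOn
  have h1 : tau (γ a) ≤ tau (γ t) := hmono (left_mem_Icc.mpr hab.le) ht ht.1
  have h2 : tau (γ t) ≤ tau (γ b) := hmono ht (right_mem_Icc.mpr hab.le) ht.2
  have h3 := (hdist hat (hγ.mono (Icc_subset_Icc_right ht.2))).2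
  have h4 : |tau (γ a) - tau (γ t)| ≤ 2 * (r / (2 * C + 1)) := by
    have h5 := (abs_le.mp (abs_tau_sub_le_dist (γ a) p)).1
    have h6 := (abs_le.mp (abs_tau_sub_le_dist (γ b) p)).2
    rw [abs_sub_comm, abs_of_nonneg (sub_nonneg.mpr h1)]
    linarith
  calc dist (γ t) p ≤ dist (γ a) (γ t) + dist (γ a) p := dist_triangle_left _ _ _
    _ < C * (2 * (r / (2 * C + 1))) + r / (2 * C + 1) :=
        add_lt_add_of_le_of_lt (h3.trans (mul_le_mul_of_nonneg_left h4 hC)) ha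
    _ = r := by field_simp

end metric

/-! ### Inextendible curves and the level sets of `τ`. -/

/-- A map dominated by a convergent real function converges. -/
theorem exists_tendsto_of_dist_le {X E : Type*} [PseudoMetricSpace E] [CompleteSpace E]
    {l : Filter X} [l.NeBot] {u : X → E} {f : X → ℝ} {C y : ℝ}
    (h : ∀ x x', dist (u x) (u x') ≤ C * |f x - f x'|) (hf : Tendsto f l (𝓝 y)) :
    ∃ p, Tendsto u l (𝓝 p) := by
  refine cauchy_map_iff_exists_tendsto.mp (cauchy_map_iff'.mpr ?_)
  rw [tendsto_uniformity_iff_dist_tendsto_zero]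
  have h1 : Tendsto (fun q : X × X => C * |f q.1 - f q.2|) (l ×ˢ l) (𝓝 0) := by
    have h2 : Tendsto (fun q : X × X => f q.1 - f q.2) (l ×ˢ l) (𝓝 (y - y)) :=
      (hf.comp tendsto_fst).sub (hf.comp tendsto_snd)
    simpa using h2.abs.const_mul C
  exact squeeze_zero (fun _ => dist_nonneg) (fun q => h q.1 q.2) h1

/-- The values of `τ` on the curve form an interval. If it misses `a`, then `τ` is bounded by `a`
towards one end and converges there by monotonicity; the distance bound makes the curve converge
too, against inextendibility. -/
theorem existsUnique_tau_eq {θ σ ε c : ℝ} {η : ℝ → ℝ} (hθ : 0 < θ)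
    (hF : Continuous (confFactor (σ / θ) ε η)) (hc : 0 < c)
    (hcF : ∀ x, c ≤ confFactor (σ / θ) ε η x) (a : ℝ) {γ : ℝ → DoubledRegion} {I : Set ℝ}
    (hγ : IsInextendibleCausalCurve (smoothedMetric θ σ η ε) γ I) :
    ∃! t, t ∈ I ∧ tau (γ t) = a := by
  have : Fact (0 < 2 * Real.pi) := ⟨Real.two_pi_pos⟩
  obtain ⟨C, hC, hdist⟩ := IsCausalCurveOn.dist_le (σ := σ) hθ hF hc hcF
  have hsub : ∀ {s t}, s ∈ I → t ∈ I → Icc s t ⊆ I := fun hs ht => hγ.ordConnected.out hs ht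
  have hmono : StrictMonoOn (fun t => tau (γ t)) I := fun s hs t ht hst =>
    (hdist hst (hγ.causal.mono (hsub hs ht))).1 (left_mem_Icc.mpr hst.le)
      (right_mem_Icc.mpr hst.le) hst
  have hle : ∀ s t : I, dist (γ s) (γ t) ≤ C * |tau (γ s) - tau (γ t)| := by
    intro s t
    rcases lt_trichotomy (s : ℝ) t with hst | hst | hst
    · exact (hdist hst (hγ.causal.mono (hsub s.2 t.2))).2
    · simp [hst]
    · rw [dist_comm, abs_sub_comm]
      exact (hdist hst (hγ.causal.mono (hsub t.2 s.2))).2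
  have hcont : ContinuousOn (fun t => tau (γ t)) I :=
    (continuous_fst.comp continuous_snd).comp_continuousOn hγ.causal.1.continuousOn
  have himage : ((fun t => tau (γ t)) '' I).OrdConnected :=
    (hγ.ordConnected.isPreconnected.image _ hcont).ordConnected
  have hmono' : Monotone fun t : I => tau (γ t) := fun s t hst => hmono.monotoneOn s.2 t.2 hst
  obtain ⟨t₀, ht₀⟩ := hγ.nontrivial.nonempty
  have : Nonempty I := ⟨⟨t₀, ht₀⟩⟩
  refine existsUnique_of_exists_of_unique ?_ fun s t hs ht =>
    hmono.injOn hs.1 ht.1 (hs.2.trans ht.2.symm)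
  change a ∈ (fun t => tau (γ t)) '' I
  by_contra hcon
  rcases le_total (tau (γ t₀)) a with h | h
  · refine hγ.no_future_endpoint (exists_tendsto_of_dist_le hle
      (tendsto_atTop_ciSup hmono' ⟨a, ?_⟩))
    rintro _ ⟨t, rfl⟩
    by_contra ht
    exact hcon (himage.out (mem_image_of_mem _ ht₀) (mem_image_of_mem _ t.2) ⟨h, (not_le.mp ht).le⟩)
  · refine hγ.no_past_endpoint (exists_tendsto_of_dist_le hle
      (tendsto_atBot_ciInf hmono' ⟨a, ?_⟩))
    rintro _ ⟨t, rfl⟩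
    by_contra ht
    exact hcon (himage.out (mem_image_of_mem _ t.2) (mem_image_of_mem _ ht₀) ⟨(not_le.mp ht).le, h⟩)

end SpinParticle

theorem lemma3p3 (θ σ ε : ℝ) (hθ : 0 < θ) (hσ : σ ≠ 0) (hε : 0 < ε)
    (η : ℝ → ℝ) (hη : SpinParticle.IsBump η) :
    SpinParticle.IsGloballyHyperbolic (SpinParticle.smoothedMetric θ σ η ε) ∧
      ∀ a : ℝ, SpinParticle.IsCauchySurface (SpinParticle.smoothedMetric θ σ η ε)
        {p | SpinParticle.tau p = a} := by
  have hF := (SpinParticle.contDiff_confFactor (σ / θ) hε hη).continuous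
  obtain ⟨c, hc, hcF⟩ :=
    SpinParticle.exists_pos_le_confFactor (div_ne_zero hσ hθ.ne') hε hη
  exact ⟨⟨SpinParticle.isSpacetime_smoothedMetric hθ hσ hε hη,
      SpinParticle.isStronglyCausal_smoothedMetric hθ hF hc hcF,
      SpinParticle.isCompact_causalDiamond hθ hF hc hcF⟩,
    fun a => ⟨⟨(0, a, 0), rfl⟩,
      SpinParticle.isSpacelikeSurface_tau_eq hθ (fun x => hc.trans_le (hcF x)) a,
      fun _ _ hγ => SpinParticle.existsUnique_tau_eq hθ hF hc hcF a hγ⟩⟩
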